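/- Let $L$ be a finite-dimensional solvable Lie algebra over a field $F$ (of any characteristic). For a finite-dimensional Lie algebra $K$ over $F$, let $\phi(K)$ (the Frattini subalgebra) be the intersection of the maximal subalgebras of $K$. Call $K$ \emph{complemented} if for every subalgebra $S$ of $K$ there is a subalgebra $T$ of $K$ with $S\cap T=0$ and $\langle S,T\rangle=K$; \emph{elementary} if $\phi(S)=0$ for every subalgebra $S$ of $K$; \emph{completely solvable} if $K^2=[K,K]$ is nilpotent. Let $\pi(K)$ (the prefrattini residual) be the intersection of all ideals $I$ of $K$ such that $K/I$ is solvable and complemented, let $E(K)$ (the elementary commutator) be the intersection of all ideals $I$ of $K$ such that $K/I$ is solvable and elementary, and let $K^\infty$ (the nilpotent residual) be the intersection of all ideals $I$ of $K$ such that $K/I$ is nilpotent. A chief series of $L$ is a chain of ideals $0=A_0\subset A_1\subset\dots\subset A_n=L$ of $L$ that cannot be refined; the factor $A_i/A_{i-1}$ is \emph{Frattini} if $A_i/A_{i-1}\subseteq\phi(L/A_{i-1})$. A \emph{prefrattini subalgebra} of $L$ is a subalgebra of the form $B=\bigcap_{i\in\mathcal I}M_i$, where, for some chief series, $\mathcal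 I$ is the set of $i$ for which $A_i/A_{i-1}$ is not Frattini and each $M_i$ is a maximal subalgebra of $L$ with $A_{i-1}\subseteq M_i$ and $A_i\not\subseteq M_i$. Then: (i) $\phi(L)\subseteq\pi(L)\subseteq E(L)$, and if $L$ is completely solvable then $\phi(L)=\pi(L)=E(L)$; (ii) if $A$ is an ideal of $L$ then $\pi(L/A)=(\pi(L)+A)/A$; in particular, $\phi(L)$ being an ideal of $L$, $\pi(L/\phi(L))=\pi(L)/\phi(L)$; (iii) $\pi(L)$ is nilpotent if and only if $\pi(L)=\phi(L)$; (iv) if $B$ is a prefrattini subalgebra of $L$ then $\pi(L)=B+\pi(L)^\infty$. -/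

import Mathlib

namespace SolvLie

/-- The Frattini subalgebra: the intersection of the maximal (proper) subalgebras. -/
def frattini (F L : Type*) [Field F] [LieRing L] [LieAlgebra F L] : LieSubalgebra F L :=
  sInf {M : LieSubalgebra F L | IsCoatom M}

/-- Every subalgebra `S` has a subalgebra `T` with `S ∩ T = 0` and `⟨S, T⟩ = L`. -/
def IsComplemented (F L : Type*) [Field F] [LieRing L] [LieAlgebra F L] : Prop :=
  ∀ S : LieSubalgebra F L, ∃ T : LieSubalgebra F L, S ⊓ T = ⊥ ∧ S ⊔ T = ⊤

/-- Every subalgebra has trivial Frattini subalgebra. -/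
def IsElementary (F L : Type*) [Field F] [LieRing L] [LieAlgebra F L] : Prop :=
  ∀ S : LieSubalgebra F L, frattini F S = ⊥

/-- `L² = [L, L]` is nilpotent. -/
def IsCompletelySolvable (F L : Type*) [Field F] [LieRing L] [LieAlgebra F L] : Prop :=
  LieRing.IsNilpotent (LieAlgebra.derivedSeries F L 1)

/-- The prefrattini residual `π(L)`: the intersection of the ideals whose quotient is a solvable
complemented Lie algebra. -/
def prefrattiniResidual (F L : Type*) [Field F] [LieRing L] [LieAlgebra F L] : LieIdeal F L :=
  sInf {I : LieIdeal F L | LieAlgebra.IsSolvable (L ⧸ I) ∧ IsComplemented F (L ⧸ I)}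

/-- The elementary commutator `E(L)`: the residual of the class of solvable elementary Lie
algebras, as the intersection of the ideals whose quotient lies in that class. -/
def elementaryCommutator (F L : Type*) [Field F] [LieRing L] [LieAlgebra F L] : LieIdeal F L :=
  sInf {I : LieIdeal F L | LieAlgebra.IsSolvable (L ⧸ I) ∧ IsElementary F (L ⧸ I)}

/-- The nilpotent residual `L^∞`: the intersection of the ideals whose quotient is a nilpotent
Lie algebra. -/
def nilpotentResidual (F L : Type*) [Field F] [LieRing L] [LieAlgebra F L] : LieIdeal F L :=
  sInf {I : LieIdeal F L | LieRing.IsNilpotent (L ⧸ I)}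

/-- A chief series `0 = A₀ ⊂ A₁ ⊂ ⋯ ⊂ Aₙ = L`: a chain of ideals of `L` with no ideal of `L`
strictly between consecutive terms. -/
structure ChiefSeries (F L : Type*) [Field F] [LieRing L] [LieAlgebra F L] where
  /-- The number of chief factors. -/
  n : ℕ
  /-- The terms. -/
  A : Fin (n + 1) → LieIdeal F L
  bot : A 0 = ⊥
  top : A (Fin.last n) = ⊤
  step : ∀ i : Fin n, A i.castSucc ⋖ A i.succ

/-- The chief factor `A (i+1) / A i` is Frattini: it is contained in `φ(L / A i)`. -/
def ChiefSeries.IsFrattini {F L : Type*} [Field F] [LieRing L] [LieAlgebra F L]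
    (s : ChiefSeries F L) (i : Fin s.n) : Prop :=
  (s.A i.succ).toSubmodule.map (LieSubmodule.Quotient.mk' (s.A i.castSucc) :
      L →ₗ[F] L ⧸ s.A i.castSucc) ≤
    (frattini F (L ⧸ s.A i.castSucc)).toSubmodule

/-- `B` is a prefrattini subalgebra: for some chief series, it is the intersection of a choice,
for each non-Frattini chief factor `A (i+1) / A i`, of a maximal subalgebra of `L` that
contains `A i` and does not contain `A (i+1)`. -/
def IsPrefrattini {F L : Type*} [Field F] [LieRing L] [LieAlgebra F L]
    (B : LieSubalgebra F L) : Prop :=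
  ∃ (s : ChiefSeries F L) (M : Fin s.n → LieSubalgebra F L),
    (∀ i, ¬ s.IsFrattini i →
      IsCoatom (M i) ∧ (s.A i.castSucc).toLieSubalgebra ≤ M i ∧
        ¬ (s.A i.succ).toLieSubalgebra ≤ M i) ∧
    B = ⨅ (i : Fin s.n) (_ : ¬ s.IsFrattini i), M i

end SolvLie

/-!
Call an ideal `J` good if `L / J` is complemented. For a chief factor `A / J` of a solvable algebra,
a maximal subalgebra `M` that contains `J` but not `A` complements `A / J`, and `J` is good as soon
as `A` is good and such an `M` exists. Hence good ideals are closed under intersection, `π(L)` is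
the least of them, and the good ideals are exactly those that contain `π(L)`.

If `π = π(L)` acts trivially on `A / J`, then `M` contains `π`, since `M ∩ (π + A)` is a good ideal;
otherwise `A` lies in `J` plus every term of the lower central series of `π`. Following a chief
series from the top with this dichotomy gives (iv).

An elementary algebra is complemented by induction: a maximal subalgebra that does not contain a
given minimal ideal `A` maps onto `L / A`. Conversely, if `φ(L) = 0` and `[L, L]` is abelian, then
`[L, L]` is a completely reducible module that splits in `L`, and both hypotheses pass to maximal
subalgebras, so `L` is elementary. A completely solvable algebra has this shape modulo `φ(L)`.
-/

namespace SolvLie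

section Ideals

variable {R L : Type*} [CommRing R] [LieRing L] [LieAlgebra R L]

theorem toLieSubalgebra_mono {A B : LieIdeal R L} (h : A ≤ B) :
    A.toLieSubalgebra ≤ B.toLieSubalgebra :=
  fun _ hx => h hx

theorem toLieSubalgebra_injective :
    Function.Injective (LieIdeal.toLieSubalgebra R L) :=
  fun _ _ h => le_antisymm (fun _ hx => h.le hx) (fun _ hx => h.ge hx)

theorem mem_sup_ideal {S : LieSubalgebra R L} {A : LieIdeal R L} {x : L} :
    x ∈ S ⊔ A.toLieSubalgebra ↔ ∃ s ∈ S, ∃ a ∈ A, s + a = x := by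
  let T : LieSubalgebra R L :=
    { S.toSubmodule ⊔ A.toSubmodule with
      lie_mem' := by
        intro x y hx hy
        obtain ⟨s, hs, a, ha, rfl⟩ := Submodule.mem_sup.1 hx
        obtain ⟨t, ht, b, hb, rfl⟩ := Submodule.mem_sup.1 hy
        refine Submodule.mem_sup.2 ⟨⁅s, t⁆, S.lie_mem hs ht, ⁅s + a, b⁆ + ⁅a, t⁆,
          A.add_mem (lie_mem_right R L A _ _ hb) (lie_mem_left R L A _ _ ha), ?_⟩
        simp only [add_lie, lie_add]
        abel }
  constructor
  · have hST : S.toSubmodule ≤ T.toSubmodule := le_sup_left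
    have hAT : A.toSubmodule ≤ T.toSubmodule := le_sup_right
    have hT : S ⊔ A.toLieSubalgebra ≤ T := sup_le hST hAT
    exact fun hx => Submodule.mem_sup.1 (hT hx)
  · rintro ⟨s, hs, a, ha, rfl⟩
    exact add_mem ((le_sup_left : S ≤ S ⊔ A.toLieSubalgebra) hs)
      ((le_sup_right : A.toLieSubalgebra ≤ S ⊔ A.toLieSubalgebra) ha)

theorem toLieSubalgebra_sup (A B : LieIdeal R L) :
    (A ⊔ B).toLieSubalgebra = A.toLieSubalgebra ⊔ B.toLieSubalgebra := by
  ext x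
  rw [mem_sup_ideal, LieIdeal.mem_toLieSubalgebra, LieSubmodule.mem_sup]
  rfl

theorem sup_ideal_inf_of_le {S T : LieSubalgebra R L} {A : LieIdeal R L} (h : S ≤ T) :
    (S ⊔ A.toLieSubalgebra) ⊓ T = S ⊔ (A.toLieSubalgebra ⊓ T) := by
  refine le_antisymm ?_ (le_inf (sup_le_sup_left inf_le_left S) (sup_le h inf_le_right))
  rintro x ⟨hx, hxT⟩
  obtain ⟨s, hs, a, ha, rfl⟩ := mem_sup_ideal.1 hx
  have haT : a ∈ T := (add_mem_cancel_left (h hs)).1 hxT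
  exact add_mem ((le_sup_left : S ≤ _) hs)
    ((le_sup_right : A.toLieSubalgebra ⊓ T ≤ S ⊔ _) ⟨ha, haT⟩)

theorem sup_ideal_inf_of_ideal_le {S T : LieSubalgebra R L} {A : LieIdeal R L}
    (h : A.toLieSubalgebra ≤ T) :
    (S ⊔ A.toLieSubalgebra) ⊓ T = (S ⊓ T) ⊔ A.toLieSubalgebra := by
  refine le_antisymm ?_ (sup_le (inf_le_inf_right T le_sup_left) (le_inf le_sup_right h))
  rintro x ⟨hx, hxT⟩
  obtain ⟨s, hs, a, ha, rfl⟩ := mem_sup_ideal.1 hx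
  exact mem_sup_ideal.2 ⟨s, ⟨hs, (add_mem_cancel_right (h ha)).1 hxT⟩, a, ha, rfl⟩

theorem inf_sup_ideal_of_sup_eq_top {M T : LieSubalgebra R L} {A : LieIdeal R L}
    (htop : M ⊔ A.toLieSubalgebra = ⊤) (h : A.toLieSubalgebra ≤ T) :
    (M ⊓ T) ⊔ A.toLieSubalgebra = T := by
  rw [← sup_ideal_inf_of_ideal_le h, htop, top_inf_eq]

theorem exists_ideal_eq_inf {M : LieSubalgebra R L} {A N : LieIdeal R L}
    (htop : M ⊔ A.toLieSubalgebra = ⊤) (h : ∀ a ∈ A, ∀ y ∈ N, y ∈ M → ⁅a, y⁆ ∈ M) :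
    ∃ D : LieIdeal R L, D.toLieSubalgebra = M ⊓ N.toLieSubalgebra := by
  refine (LieSubalgebra.exists_lieIdeal_coe_eq_iff R _).2 ?_
  rintro x y ⟨hyM, hyN⟩
  obtain ⟨m, hm, a, ha, rfl⟩ := mem_sup_ideal.1 (htop ▸ LieSubalgebra.mem_top (R := R) x)
  refine ⟨?_, lie_mem_right R L N _ _ hyN⟩
  rw [add_lie]
  exact add_mem (M.lie_mem hm hyM) (h a ha y hyN hyM)

theorem sup_ideal_eq_top {M : LieSubalgebra R L} (hM : IsCoatom M) {A : LieIdeal R L}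
    (h : ¬ A.toLieSubalgebra ≤ M) : M ⊔ A.toLieSubalgebra = ⊤ :=
  hM.2 _ (left_lt_sup.2 h)

theorem covBy_of_toLieSubalgebra_eq_inf {M : LieSubalgebra R L} (hM : IsCoatom M)
    {D N : LieIdeal R L} (hN : ¬ N.toLieSubalgebra ≤ M)
    (hD : D.toLieSubalgebra = M ⊓ N.toLieSubalgebra) : D ⋖ N := by
  have hDM : D.toLieSubalgebra ≤ M := hD.trans_le inf_le_left
  refine ⟨lt_of_le_of_ne (fun x hx => (hD.le hx).2) fun h => hN (h ▸ hDM), fun X hDX hXN => ?_⟩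
  have hXM : ¬ X.toLieSubalgebra ≤ M :=
    fun hXM => hDX.not_ge fun x hx => hD.ge ⟨hXM hx, hXN.le hx⟩
  have hN_eq := inf_sup_ideal_of_sup_eq_top (sup_ideal_eq_top hM hXM) (toLieSubalgebra_mono hXN.le)
  rw [← hD, sup_eq_right.2 (toLieSubalgebra_mono hDX.le)] at hN_eq
  exact hXN.ne (toLieSubalgebra_injective hN_eq)

theorem lie_sup_sup_le (J D E : LieIdeal R L) : ⁅J ⊔ D, J ⊔ E⁆ ≤ J ⊔ ⁅D, E⁆ := by
  rw [LieSubmodule.sup_lie, LieSubmodule.lie_sup (I := D)]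
  refine sup_le ((LieSubmodule.lie_le_left J (J ⊔ E)).trans le_sup_left) ?_
  exact sup_le_sup_right (LieSubmodule.lie_le_right J D) _

end Ideals

section ChiefFactors

variable {R L : Type*} [CommRing R] [LieRing L] [LieAlgebra R L]

theorem lie_self_le_of_covBy [LieAlgebra.IsSolvable L] {J A : LieIdeal R L} (h : J ⋖ A) :
    ⁅A, A⁆ ≤ J := by
  rcases h.eq_or_eq (c := J ⊔ ⁅A, A⁆) le_sup_left
    (sup_le h.le (LieSubmodule.lie_le_right _ _)) with hJ | hA
  · exact hJ ▸ le_sup_right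
  have hle : ∀ k, A ≤ J ⊔ LieAlgebra.derivedSeries R L k := by
    intro k
    induction k with
    | zero => simp [LieAlgebra.derivedSeries_def]
    | succ k ih =>
      rw [LieAlgebra.derivedSeries_def, LieAlgebra.derivedSeriesOfIdeal_succ,
        ← LieAlgebra.derivedSeries_def]
      exact hA.ge.trans
        (sup_le le_sup_left ((LieSubmodule.mono_lie ih ih).trans (lie_sup_sup_le _ _ _)))
  obtain ⟨k, hk⟩ := LieAlgebra.IsSolvable.solvable R L
  exact absurd (by simpa [hk] using hle k) h.lt.not_ge

theorem inf_eq_of_covBy [LieAlgebra.IsSolvable L] {J A : LieIdeal R L} (h : J ⋖ A)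
    {M : LieSubalgebra R L} (htop : M ⊔ A.toLieSubalgebra = ⊤) (hJ : J.toLieSubalgebra ≤ M)
    (hA : ¬ A.toLieSubalgebra ≤ M) : M ⊓ A.toLieSubalgebra = J.toLieSubalgebra := by
  obtain ⟨D, hD⟩ := exists_ideal_eq_inf (N := A) htop fun a ha y hy _ =>
    hJ (lie_self_le_of_covBy h (LieSubmodule.lie_mem_lie ha hy))
  rcases h.eq_or_eq (c := D) (fun x hx => hD.ge ⟨hJ hx, h.le hx⟩)
    (fun x hx => (hD.le hx).2) with rfl | rfl
  · exact hD.symm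
  · exact absurd (hD.trans_le inf_le_left) hA

/-- `M` is a maximal subalgebra that avoids the factor `A / J`: it contains `J` but not `A`. For a
chief factor of a solvable Lie algebra, `M / J` is then a complement of `A / J` in `L / J`. -/
structure IsMaximalSupplement (M : LieSubalgebra R L) (J A : LieIdeal R L) : Prop where
  isCoatom : IsCoatom M
  le : J.toLieSubalgebra ≤ M
  not_le : ¬ A.toLieSubalgebra ≤ M

namespace IsMaximalSupplement

variable {M : LieSubalgebra R L} {J A : LieIdeal R L}

theorem sup_eq_top (hM : IsMaximalSupplement M J A) : M ⊔ A.toLieSubalgebra = ⊤ :=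
  sup_ideal_eq_top hM.isCoatom hM.not_le

theorem inf_eq [LieAlgebra.IsSolvable L] (hM : IsMaximalSupplement M J A) (h : J ⋖ A) :
    M ⊓ A.toLieSubalgebra = J.toLieSubalgebra :=
  inf_eq_of_covBy h hM.sup_eq_top hM.le hM.not_le

theorem of_le {J' : LieIdeal R L} (hM : IsMaximalSupplement M J A) (h : J' ≤ J) :
    IsMaximalSupplement M J' A :=
  ⟨hM.isCoatom, (toLieSubalgebra_mono h).trans hM.le, hM.not_le⟩

end IsMaximalSupplement

end ChiefFactors

section Complemented

variable {R L : Type*} [CommRing R] [LieRing L] [LieAlgebra R L]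

/-- The Lie algebra `L / I` is complemented, expressed through the subalgebras of `L` that
contain `I`. -/
def IsComplementedOver (I : LieIdeal R L) : Prop :=
  ∀ S : LieSubalgebra R L, I.toLieSubalgebra ≤ S →
    ∃ T : LieSubalgebra R L, I.toLieSubalgebra ≤ T ∧ S ⊓ T = I.toLieSubalgebra ∧ S ⊔ T = ⊤

theorem isComplementedOver_top : IsComplementedOver (⊤ : LieIdeal R L) :=
  fun S hS => ⟨⊤, le_top, (inf_top_eq S).trans (hS.antisymm' le_top), sup_top_eq S⟩

namespace IsComplementedOver

theorem mono {I J : LieIdeal R L} (hI : IsComplementedOver I) (h : I ≤ J) :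
    IsComplementedOver J := by
  intro S hS
  obtain ⟨T, -, hST, htop⟩ := hI S ((toLieSubalgebra_mono h).trans hS)
  refine ⟨T ⊔ J.toLieSubalgebra, le_sup_right, ?_, ?_⟩
  · rw [inf_comm, sup_ideal_inf_of_ideal_le hS, inf_comm, hST]
    exact sup_eq_right.2 (toLieSubalgebra_mono h)
  · rw [← sup_assoc, htop, top_sup_eq]

theorem exists_isMaximalSupplement [IsNoetherian R L] {I A : LieIdeal R L}
    (hI : IsComplementedOver I) (h : ¬ A ≤ I) : ∃ M, IsMaximalSupplement M I A := by
  obtain ⟨T, hIT, hinf, htop⟩ := hI (I ⊔ A).toLieSubalgebra (toLieSubalgebra_mono le_sup_left)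
  have hT : T ≠ ⊤ := by
    rintro rfl
    rw [inf_top_eq] at hinf
    exact h (le_sup_right.trans (toLieSubalgebra_injective hinf).le)
  obtain ⟨M, hM, hTM⟩ := (eq_top_or_exists_le_coatom T).resolve_left hT
  refine ⟨M, hM, hIT.trans hTM, fun hAM => hM.1 (top_le_iff.1 ?_)⟩
  rw [← htop, toLieSubalgebra_sup]
  exact sup_le (sup_le (hIT.trans hTM) hAM) hTM

theorem of_covBy [LieAlgebra.IsSolvable L] {J A : LieIdeal R L} (hA : IsComplementedOver A)
    (h : J ⋖ A) {M : LieSubalgebra R L} (hM : IsMaximalSupplement M J A) :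
    IsComplementedOver J := by
  intro S hJS
  have hJA := toLieSubalgebra_mono h.le
  obtain ⟨T, hAT, hST, htop⟩ := hA (S ⊔ A.toLieSubalgebra) le_sup_right
  have hMT : (M ⊓ T) ⊔ A.toLieSubalgebra = T := inf_sup_ideal_of_sup_eq_top hM.sup_eq_top hAT
  have htop' : S ⊔ T = ⊤ := by rwa [sup_assoc, sup_eq_right.2 hAT] at htop
  have hKA : (S ⊔ (M ⊓ T)) ⊔ A.toLieSubalgebra = ⊤ := by rw [sup_assoc, hMT, htop']
  by_cases hAK : A.toLieSubalgebra ≤ S ⊔ (M ⊓ T)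
  · refine ⟨M ⊓ T, le_inf hM.le (hJA.trans hAT), le_antisymm ?_ ?_, ?_⟩
    · rw [← hM.inf_eq h, ← hST]
      exact le_inf (inf_le_right.trans inf_le_left) (inf_le_inf le_sup_left inf_le_right)
    · exact le_inf hJS (le_inf hM.le (hJA.trans hAT))
    · rwa [sup_eq_left.2 hAK] at hKA
  · refine ⟨T, hJA.trans hAT, le_antisymm ?_ (le_inf hJS (hJA.trans hAT)), htop'⟩
    rw [← inf_eq_of_covBy h hKA (hJS.trans le_sup_left) hAK]
    exact le_inf (inf_le_left.trans le_sup_left)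
      ((inf_le_inf_right T le_sup_left).trans hST.le)

theorem inf [IsNoetherian R L] [IsArtinian R L] [LieAlgebra.IsSolvable L] {I I' : LieIdeal R L}
    (hI : IsComplementedOver I) (hI' : IsComplementedOver I') : IsComplementedOver (I ⊓ I') := by
  have : WellFoundedLT (LieIdeal R L) := LieSubmodule.wellFoundedLT_of_isArtinian R L L
  suffices ∀ J : LieIdeal R L, I ⊓ I' ≤ J → J ≤ I → IsComplementedOver J from
    this _ le_rfl inf_le_left
  intro J
  induction J using WellFoundedGT.induction with
  | ind J ih =>
    intro hJ hJI
    rcases hJI.eq_or_lt with rfl | hlt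
    · exact hI
    obtain ⟨A, hJA, hAI⟩ := exists_covBy_le_of_lt hlt
    have hA : ¬ A ≤ J ⊔ I' := fun hle => hJA.lt.not_ge <|
      calc A ≤ (J ⊔ I') ⊓ A := le_inf hle le_rfl
        _ ≤ J ⊔ (I' ⊓ A) := sup_inf_le_assoc_of_le _ hJA.le
        _ ≤ J := sup_le le_rfl ((le_inf (inf_le_right.trans hAI) inf_le_left).trans hJ)
    obtain ⟨M, hM⟩ := (hI'.mono le_sup_right).exists_isMaximalSupplement hA
    exact (ih A hJA.lt (hJ.trans hJA.le) hAI).of_covBy hJA (hM.of_le le_sup_left)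

end IsComplementedOver

end Complemented

section Quotients

variable {R L L' : Type*} [CommRing R] [LieRing L] [LieAlgebra R L] [LieRing L'] [LieAlgebra R L']

/-- The correspondence between the subalgebras of a homomorphic image and the subalgebras of the
source that contain the kernel. -/
def subalgebraOrderIso (f : L →ₗ⁅R⁆ L') (hf : Function.Surjective f) :
    LieSubalgebra R L' ≃o Set.Ici f.ker.toLieSubalgebra where
  toFun S := ⟨S.comap f, fun x hx => by
    have hfx : f x = 0 := hx
    exact (hfx ▸ S.zero_mem : f x ∈ S)⟩
  invFun S := S.1.map f
  left_inv S := by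
    ext y
    obtain ⟨x, rfl⟩ := hf y
    exact ⟨fun ⟨_, hz, hzx⟩ => hzx ▸ hz, fun h => ⟨x, h, rfl⟩⟩
  right_inv S := by
    refine Subtype.ext (le_antisymm ?_ fun x hx => ⟨x, hx, rfl⟩)
    rintro x ⟨s, hs, hsx⟩
    have hk : x - s ∈ f.ker := by
      rw [LieHom.mem_ker, map_sub, sub_eq_zero]
      exact hsx.symm
    simpa using add_mem (S.2 hk) hs
  map_rel_iff' {S T} := by
    refine ⟨fun h y hy => ?_, fun h x hx => h hx⟩
    obtain ⟨x, rfl⟩ := hf y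
    exact h hy

theorem complementedLattice_subalgebra_iff {f : L →ₗ⁅R⁆ L'} (hf : Function.Surjective f) :
    ComplementedLattice (LieSubalgebra R L') ↔ IsComplementedOver f.ker := by
  rw [(subalgebraOrderIso f hf).complementedLattice_iff, complementedLattice_iff]
  simp only [IsComplementedOver, Set.Ici.isCompl_iff, codisjoint_iff, Subtype.forall, Set.mem_Ici,
    Subtype.exists, exists_prop]

/-- The quotient map, as a homomorphism of Lie algebras. -/
def quotientHom (I : LieIdeal R L) : L →ₗ⁅R⁆ L ⧸ I where
  toLinearMap := (LieSubmodule.Quotient.mk' I : L →ₗ[R] L ⧸ I)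
  map_lie' := rfl

theorem quotientHom_surjective (I : LieIdeal R L) : Function.Surjective (quotientHom I) :=
  LieSubmodule.Quotient.surjective_mk' I

theorem ker_quotientHom (I : LieIdeal R L) : (quotientHom I).ker = I := by
  ext x
  exact LieSubmodule.Quotient.mk_eq_zero' (N := I)

theorem ker_quotientHom_comp_quotientHom {A : LieIdeal R L} (I : LieIdeal R (L ⧸ A)) :
    ((quotientHom I).comp (quotientHom A)).ker = I.comap (quotientHom A) := by
  ext x
  exact LieSubmodule.Quotient.mk_eq_zero' (N := I)

theorem map_mk_sup_self (N A : LieIdeal R L) :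
    (N ⊔ A).toSubmodule.map (LieSubmodule.Quotient.mk' A : L →ₗ[R] L ⧸ A) =
      N.toSubmodule.map (LieSubmodule.Quotient.mk' A : L →ₗ[R] L ⧸ A) := by
  have hA : A.toSubmodule.map (LieSubmodule.Quotient.mk' A : L →ₗ[R] L ⧸ A) = ⊥ :=
    LinearMap.le_ker_iff_map.1 fun x hx => LieSubmodule.Quotient.mk_eq_zero'.2 hx
  rw [LieSubmodule.sup_toSubmodule, Submodule.map_sup, hA, sup_bot_eq]

instance isSolvable_subalgebra [LieAlgebra.IsSolvable L] (S : LieSubalgebra R L) :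
    LieAlgebra.IsSolvable S :=
  Function.Injective.lieAlgebra_isSolvable (f := S.incl) Subtype.val_injective

instance isSolvable_quotient [LieAlgebra.IsSolvable L] (I : LieIdeal R L) :
    LieAlgebra.IsSolvable (L ⧸ I) :=
  (quotientHom_surjective I).lieAlgebra_isSolvable

end Quotients

section Frattini

variable {F L L' : Type*} [Field F] [LieRing L] [LieAlgebra F L] [LieRing L'] [LieAlgebra F L']

theorem isComplemented_iff_of_surjective {f : L →ₗ⁅F⁆ L'} (hf : Function.Surjective f) :
    IsComplemented F L' ↔ IsComplementedOver f.ker := by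
  rw [← complementedLattice_subalgebra_iff hf, complementedLattice_iff]
  simp only [IsComplemented, isCompl_iff, disjoint_iff, codisjoint_iff]

theorem isComplemented_quotient_iff (I : LieIdeal F L) :
    IsComplemented F (L ⧸ I) ↔ IsComplementedOver I := by
  rw [isComplemented_iff_of_surjective (quotientHom_surjective I), ker_quotientHom]

theorem isComplemented_quotient_quotient_iff {A : LieIdeal F L} (I : LieIdeal F (L ⧸ A)) :
    IsComplemented F ((L ⧸ A) ⧸ I) ↔ IsComplementedOver (I.comap (quotientHom A)) := by
  have hsurj : Function.Surjective ((quotientHom I).comp (quotientHom A)) :=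
    (quotientHom_surjective I).comp (quotientHom_surjective A)
  rw [← ker_quotientHom_comp_quotientHom, isComplemented_iff_of_surjective hsurj]

theorem frattini_le {M : LieSubalgebra F L} (hM : IsCoatom M) : frattini F L ≤ M :=
  sInf_le hM

theorem mem_frattini {x : L} :
    x ∈ frattini F L ↔ ∀ M : LieSubalgebra F L, IsCoatom M → x ∈ M := by
  rw [frattini, ← SetLike.mem_coe, LieSubalgebra.coe_sInf]
  simp only [Set.mem_iInter, Set.mem_ofPred_eq, SetLike.mem_coe]

theorem eq_top_of_sup_frattini [IsNoetherian F L] {S : LieSubalgebra F L}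
    (h : S ⊔ frattini F L = ⊤) : S = ⊤ := by
  rw [frattini, sInf_eq_iInf] at h
  exact Order.radical_nongenerating h

theorem mem_of_map_mem_frattini {f : L →ₗ⁅F⁆ L'} (hf : Function.Surjective f) {x : L}
    (hx : f x ∈ frattini F L') {M : LieSubalgebra F L} (hM : IsCoatom M)
    (hker : f.ker.toLieSubalgebra ≤ M) : x ∈ M := by
  set e := subalgebraOrderIso f hf
  have hcoatom : IsCoatom (e.symm ⟨M, hker⟩) := (e.symm.isCoatom_iff _).2 (hM.Ici hker)
  have hcomap : (e.symm ⟨M, hker⟩).comap f = M :=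
    congrArg Subtype.val (e.apply_symm_apply ⟨M, hker⟩)
  exact hcomap.le (frattini_le hcoatom hx)

theorem frattini_eq_bot_of_surjective {f : L →ₗ⁅F⁆ L'} (hf : Function.Surjective f)
    (h : f.ker.toLieSubalgebra = frattini F L) : frattini F L' = ⊥ := by
  rw [eq_bot_iff]
  intro y hy
  obtain ⟨x, rfl⟩ := hf y
  exact h.ge (mem_frattini.2 fun M hM =>
    mem_of_map_mem_frattini hf hy hM (h.trans_le (frattini_le hM)))

end Frattini

section ConjugateSupplements

variable {R L : Type*} [CommRing R] [LieRing L] [LieAlgebra R L]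

/-- The image of `M` under `1 + ad a`, enlarged by `J`. It is a subalgebra because `a` lies in an
ideal that is abelian modulo `J`, so that `1 + ad a` is an automorphism modulo `J`. -/
def conjSubalgebra (M : LieSubalgebra R L) {J A : LieIdeal R L} (hA : ⁅A, A⁆ ≤ J) {a : L}
    (ha : a ∈ A) : LieSubalgebra R L where
  carrier := {z | ∃ m ∈ M, ∃ i ∈ J, m + ⁅a, m⁆ + i = z}
  add_mem' := by
    rintro _ _ ⟨m, hm, i, hi, rfl⟩ ⟨n, hn, j, hj, rfl⟩
    refine ⟨m + n, add_mem hm hn, i + j, add_mem hi hj, ?_⟩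
    rw [lie_add]; abel
  zero_mem' := ⟨0, M.zero_mem, 0, J.zero_mem, by simp⟩
  smul_mem' := by
    rintro c _ ⟨m, hm, i, hi, rfl⟩
    exact ⟨c • m, M.smul_mem c hm, c • i, J.smul_mem c hi, by simp⟩
  lie_mem' := by
    rintro _ _ ⟨m, hm, i, hi, rfl⟩ ⟨n, hn, j, hj, rfl⟩
    refine ⟨⁅m, n⁆, M.lie_mem hm hn,
      ⁅⁅a, m⁆, ⁅a, n⁆⁆ + ⁅m + ⁅a, m⁆ + i, j⁆ + ⁅i, n + ⁅a, n⁆⁆, ?_, ?_⟩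
    · have hlie : ∀ x, ⁅a, x⁆ ∈ A := fun x => lie_mem_left R L A a x ha
      exact add_mem (add_mem (hA (LieSubmodule.lie_mem_lie (hlie m) (hlie n)))
        (lie_mem_right R L J _ _ hj)) (lie_mem_left R L J _ _ hi)
    · rw [leibniz_lie a m n]
      simp only [add_lie, lie_add]
      abel

variable {M : LieSubalgebra R L} {J A : LieIdeal R L} {a : L}

theorem le_conjSubalgebra (hA : ⁅A, A⁆ ≤ J) (ha : a ∈ A) :
    J.toLieSubalgebra ≤ conjSubalgebra M hA ha :=
  fun i hi => ⟨0, M.zero_mem, i, hi, by simp⟩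

theorem add_lie_mem_conjSubalgebra (hA : ⁅A, A⁆ ≤ J) (ha : a ∈ A) {m : L} (hm : m ∈ M) :
    m + ⁅a, m⁆ ∈ conjSubalgebra M hA ha :=
  ⟨m, hm, 0, J.zero_mem, add_zero _⟩

theorem conjSubalgebra_sup_eq_top (hA : ⁅A, A⁆ ≤ J) (ha : a ∈ A)
    (htop : M ⊔ A.toLieSubalgebra = ⊤) :
    conjSubalgebra M hA ha ⊔ A.toLieSubalgebra = ⊤ := by
  rw [eq_top_iff, ← htop]
  refine sup_le (fun m hm => mem_sup_ideal.2 ⟨m + ⁅a, m⁆, add_lie_mem_conjSubalgebra hA ha hm,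
    -⁅a, m⁆, neg_mem (lie_mem_left R L A _ _ ha), by abel⟩) le_sup_right

theorem conjSubalgebra_inf_le (hA : ⁅A, A⁆ ≤ J) (ha : a ∈ A) (hJA : J ≤ A)
    (hM : M ⊓ A.toLieSubalgebra ≤ J.toLieSubalgebra) :
    conjSubalgebra M hA ha ⊓ A.toLieSubalgebra ≤ J.toLieSubalgebra := by
  rintro _ ⟨⟨m, hm, i, hi, rfl⟩, hmA⟩
  have hmA' : m ∈ A :=
    (add_mem_cancel_right (lie_mem_left R L A a m ha)).1 ((add_mem_cancel_right (hJA hi)).1 hmA)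
  have hmJ : m ∈ J := hM ⟨hm, hmA'⟩
  exact add_mem (add_mem hmJ (lie_mem_right R L J _ _ hmJ)) hi

theorem IsMaximalSupplement.exists_conj [IsNoetherian R L] [LieAlgebra.IsSolvable L]
    (hM : IsMaximalSupplement M J A) (h : J ⋖ A) (ha : a ∈ A) :
    ∃ K, IsMaximalSupplement K J A ∧ ∀ m ∈ M, m + ⁅a, m⁆ ∈ K := by
  have hAA := lie_self_le_of_covBy h
  have hinf := conjSubalgebra_inf_le hAA ha h.le (hM.inf_eq h).le
  have hsup := conjSubalgebra_sup_eq_top hAA ha hM.sup_eq_top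
  have hne : conjSubalgebra M hAA ha ≠ ⊤ := fun htop => by
    rw [htop, top_inf_eq] at hinf
    exact h.lt.not_ge hinf
  obtain ⟨K, hK, hTK⟩ := (eq_top_or_exists_le_coatom _).resolve_left hne
  exact ⟨K, ⟨hK, (le_conjSubalgebra hAA ha).trans hTK,
    fun hAK => hK.1 (top_le_iff.1 (hsup.ge.trans (sup_le hTK hAK)))⟩,
    fun m hm => hTK (add_lie_mem_conjSubalgebra hAA ha hm)⟩

end ConjugateSupplements

section FrattiniIdeal

/-- The centralizer in `L` of the factor `A / J`. -/
def factorCentralizer {R L : Type*} [CommRing R] [LieRing L] [LieAlgebra R L]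
    (J A : LieIdeal R L) : LieIdeal R L where
  carrier := {y | ∀ a ∈ A, ⁅a, y⁆ ∈ J}
  add_mem' hy hz a ha := by
    rw [lie_add]
    exact add_mem (hy a ha) (hz a ha)
  zero_mem' a _ := by
    rw [lie_zero]
    exact J.zero_mem
  smul_mem' c y hy a ha := by
    rw [lie_smul]
    exact J.smul_mem c (hy a ha)
  lie_mem {x y} hy a ha := by
    rw [leibniz_lie]
    exact add_mem (hy _ (lie_mem_left R L A a x ha)) (lie_mem_right R L J _ _ (hy a ha))

variable {F L : Type*} [Field F] [LieRing L] [LieAlgebra F L] [FiniteDimensional F L]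

theorem engel_eq_top_of_lie_mem_frattini {x : L} (hx : ∀ y, ⁅x, y⁆ ∈ frattini F L) :
    LieSubalgebra.engel F x = ⊤ := by
  refine eq_top_of_sup_frattini (top_le_iff.1 fun y _ => ?_)
  obtain ⟨n, hn⟩ := Filter.eventually_atTop.1
    (LinearMap.eventually_codisjoint_ker_pow_range_pow (LieAlgebra.ad F L x))
  have hy : y ∈ LinearMap.ker (LieAlgebra.ad F L x ^ (n + 1)) ⊔
      LinearMap.range (LieAlgebra.ad F L x ^ (n + 1)) :=
    (hn (n + 1) n.le_succ).eq_top ▸ Submodule.mem_top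
  obtain ⟨u, hu, _, ⟨v, rfl⟩, rfl⟩ := Submodule.mem_sup.1 hy
  have hu' : u ∈ LieSubalgebra.engel F x := (LieSubalgebra.mem_engel_iff F x u).2 ⟨n + 1, hu⟩
  have hv : (LieAlgebra.ad F L x ^ (n + 1)) v ∈ frattini F L := by
    rw [pow_succ']
    exact hx _
  exact add_mem ((le_sup_left : LieSubalgebra.engel F x ≤ _) hu')
    ((le_sup_right : frattini F L ≤ _) hv)

theorem isNilpotent_of_le_frattini {P : LieIdeal F L} (hP : P.toLieSubalgebra ≤ frattini F L) :
    LieRing.IsNilpotent P :=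
  LieSubalgebra.isNilpotent_of_forall_le_engel (R := F) P.toLieSubalgebra fun x hx =>
    (engel_eq_top_of_lie_mem_frattini fun y => hP (lie_mem_left F L P x y hx)) ▸ le_top

variable [LieAlgebra.IsSolvable L]

/-- Both `x` and, by conjugating `M`, its image under `1 + ad a` lie in a maximal subalgebra that
meets `A` in `J`. -/
theorem IsMaximalSupplement.lie_mem {M : LieSubalgebra F L} {J A : LieIdeal F L}
    (hM : IsMaximalSupplement M J A) (h : J ⋖ A) {a x : L} (ha : a ∈ A)
    (hx : x ∈ frattini F L) : ⁅a, x⁆ ∈ J := by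
  obtain ⟨K, hK, hMK⟩ := hM.exists_conj h ha
  have hK_lie : ⁅a, x⁆ ∈ K := (add_mem_cancel_left (frattini_le hK.isCoatom hx)).1
    (hMK x (frattini_le hM.isCoatom hx))
  exact (hK.inf_eq h).le ⟨hK_lie, lie_mem_left F L A a x ha⟩

theorem exists_ideal_frattini_le_and_le {M : LieSubalgebra F L} (hM : IsCoatom M) :
    ∃ C : LieIdeal F L, frattini F L ≤ C.toLieSubalgebra ∧ C.toLieSubalgebra ≤ M := by
  have : WellFoundedLT (LieIdeal F L) := LieSubmodule.wellFoundedLT_of_isArtinian F L L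
  obtain ⟨J, hJM, hJmax⟩ := WellFounded.has_min (wellFounded_gt (α := LieIdeal F L))
    {J | J.toLieSubalgebra ≤ M} ⟨⊥, bot_le (a := M)⟩
  have hJ : J < ⊤ := lt_top_iff_ne_top.2 fun h => hM.1 (top_le_iff.1 fun x _ => hJM (by simp [h]))
  obtain ⟨A, hJA, -⟩ := exists_covBy_le_of_lt hJ
  have hMA : IsMaximalSupplement M J A := ⟨hM, hJM, fun hAM => hJmax A hAM hJA.lt⟩
  obtain ⟨C, hC⟩ := exists_ideal_eq_inf (N := factorCentralizer J A) hMA.sup_eq_top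
    fun a ha y hy _ => hJM (hy a ha)
  refine ⟨C, hC ▸ le_inf (frattini_le hM) fun x hx a ha => ?_, hC.trans_le inf_le_left⟩
  exact hMA.lie_mem hJA ha hx

theorem exists_ideal_eq_frattini : ∃ P : LieIdeal F L, P.toLieSubalgebra = frattini F L := by
  refine (LieSubalgebra.exists_lieIdeal_coe_eq_iff F _).2 fun x y hy =>
    mem_frattini.2 fun M hM => ?_
  obtain ⟨C, hφC, hCM⟩ := exists_ideal_frattini_le_and_le hM
  exact hCM (lie_mem_right F L C x y (hφC hy))

end FrattiniIdeal

section PrefrattiniResidual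

variable {F L : Type*} [Field F] [LieRing L] [LieAlgebra F L] [LieAlgebra.IsSolvable L]

theorem prefrattiniResidual_le {I : LieIdeal F L} (h : IsComplementedOver I) :
    prefrattiniResidual F L ≤ I :=
  sInf_le ⟨inferInstance, (isComplemented_quotient_iff I).2 h⟩

variable [FiniteDimensional F L]

theorem isComplementedOver_prefrattiniResidual :
    IsComplementedOver (prefrattiniResidual F L) := by
  have hwf : WellFoundedLT (LieIdeal F L) := LieSubmodule.wellFoundedLT_of_isArtinian F L L
  obtain ⟨I, hI, hmin⟩ := hwf.wf.has_min {I : LieIdeal F L | IsComplementedOver I}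
    ⟨⊤, isComplementedOver_top⟩
  refine hI.mono (le_sInf fun J ⟨_, hJ⟩ => inf_eq_left.1 ?_)
  exact (inf_le_left.lt_or_eq).resolve_left
    (hmin _ (hI.inf ((isComplemented_quotient_iff J).1 hJ)))

theorem prefrattiniResidual_le_iff {I : LieIdeal F L} :
    prefrattiniResidual F L ≤ I ↔ IsComplementedOver I :=
  ⟨isComplementedOver_prefrattiniResidual.mono, prefrattiniResidual_le⟩

theorem prefrattiniResidual_quotient_eq_map (A : LieIdeal F L) :
    prefrattiniResidual F (L ⧸ A) = (prefrattiniResidual F L).map (quotientHom A) :=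
  eq_of_forall_ge_iff fun I => by
    rw [LieIdeal.map_le_iff_le_comap, prefrattiniResidual_le_iff, prefrattiniResidual_le_iff,
      ← isComplemented_quotient_iff, isComplemented_quotient_quotient_iff]

theorem toSubmodule_prefrattiniResidual_quotient (A : LieIdeal F L) :
    (prefrattiniResidual F (L ⧸ A)).toSubmodule =
      (prefrattiniResidual F L).toSubmodule.map
        (LieSubmodule.Quotient.mk' A : L →ₗ[F] L ⧸ A) := by
  rw [prefrattiniResidual_quotient_eq_map,
    LieIdeal.coe_map_of_surjective (quotientHom_surjective A)]
  rfl

theorem frattini_le_prefrattiniResidual :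
    frattini F L ≤ (prefrattiniResidual F L).toLieSubalgebra := by
  obtain ⟨P, hP⟩ := exists_ideal_eq_frattini (F := F) (L := L)
  by_contra hle
  have hPπ : ¬ P ≤ prefrattiniResidual F L := fun h => hle (hP ▸ toLieSubalgebra_mono h)
  obtain ⟨M, hM⟩ := isComplementedOver_prefrattiniResidual.exists_isMaximalSupplement hPπ
  exact hM.not_le (hP.trans_le (frattini_le hM.isCoatom))

end PrefrattiniResidual

section LowerCentral

variable {R L : Type*} [CommRing R] [LieRing L] [LieAlgebra R L]

/-- The terms of the lower central series of an ideal `N`, as ideals of the whole Lie algebra;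
`lowerCentral N 0 = N`. -/
def lowerCentral (N : LieIdeal R L) (k : ℕ) : LieIdeal R L :=
  (N.lcs N k).map (LieSubmodule.incl N)

theorem lowerCentral_zero (N : LieIdeal R L) : lowerCentral N 0 = N := by
  ext x
  simp [lowerCentral]

theorem lowerCentral_succ (N : LieIdeal R L) (k : ℕ) :
    lowerCentral N (k + 1) = ⁅N, lowerCentral N k⁆ := by
  rw [lowerCentral, LieIdeal.lcs_succ, LieSubmodule.map_bracket_eq, lowerCentral]

theorem mem_lowerCentral_iff {N : LieIdeal R L} {k : ℕ} {x : L} :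
    x ∈ lowerCentral N k ↔ ∃ y ∈ LieModule.lowerCentralSeries R N N k, (y : L) = x := by
  rw [lowerCentral, LieSubmodule.mem_map]
  refine exists_congr fun y => and_congr_left fun _ => ?_
  rw [← LieSubmodule.mem_toSubmodule, N.coe_lcs_eq (M := N) k]
  rfl

theorem lowerCentral_le (N : LieIdeal R L) (k : ℕ) : lowerCentral N k ≤ N := by
  intro x hx
  obtain ⟨y, -, rfl⟩ := mem_lowerCentral_iff.1 hx
  exact y.2

theorem exists_lowerCentral_eq_bot {N : LieIdeal R L} (h : LieRing.IsNilpotent N) :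
    ∃ k, lowerCentral N k = ⊥ := by
  obtain ⟨k, hk⟩ := LieModule.IsNilpotent.nilpotent R N N
  refine ⟨k, eq_bot_iff.2 fun x hx => ?_⟩
  obtain ⟨y, hy, rfl⟩ := mem_lowerCentral_iff.1 hx
  rw [hk, LieSubmodule.mem_bot] at hy
  simp [hy]

theorem exists_ideal_eq_inf_of_lowerCentral_le {M : LieSubalgebra R L} (hM : IsCoatom M)
    {N : LieIdeal R L} (hN : ¬ N.toLieSubalgebra ≤ M) {k : ℕ}
    (hk : (lowerCentral N k).toLieSubalgebra ≤ M) :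
    ∃ D : LieIdeal R L, D.toLieSubalgebra = M ⊓ N.toLieSubalgebra := by
  induction k with
  | zero => exact absurd (lowerCentral_zero N ▸ hk) hN
  | succ k ih =>
    by_cases h : (lowerCentral N k).toLieSubalgebra ≤ M
    · exact ih h
    refine exists_ideal_eq_inf (sup_ideal_eq_top hM h) fun a ha y hy _ => hk ?_
    rw [LieIdeal.mem_toLieSubalgebra, lowerCentral_succ, LieSubmodule.lie_comm]
    exact LieSubmodule.lie_mem_lie ha hy

theorem lie_le_or_le_lowerCentral_sup {J A : LieIdeal R L} (h : J ⋖ A) (N : LieIdeal R L) :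
    ⁅N, A⁆ ≤ J ∨ ∀ k, A ≤ lowerCentral N k ⊔ J := by
  rcases h.eq_or_eq (c := ⁅N, A⁆ ⊔ J) le_sup_right
    (sup_le (LieSubmodule.lie_le_right A N) h.le) with hJ | hA
  · exact Or.inl (hJ ▸ le_sup_left)
  refine Or.inr fun k => ?_
  induction k with
  | zero =>
    rw [lowerCentral_zero]
    exact hA.ge.trans (sup_le_sup_right (LieSubmodule.lie_le_left N A) J)
  | succ k ih =>
    refine hA.ge.trans (sup_le ((LieSubmodule.mono_lie_right N ih).trans ?_) le_sup_right)
    rw [LieSubmodule.lie_sup, ← lowerCentral_succ]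
    exact sup_le_sup_left (LieSubmodule.lie_le_right J N) _

theorem exists_lowerCentralSeries_le_of_isNilpotent_quotient {I : LieIdeal R L}
    (h : LieRing.IsNilpotent (L ⧸ I)) : ∃ k, LieModule.lowerCentralSeries R L L k ≤ I := by
  obtain ⟨k, hk⟩ := LieModule.IsNilpotent.nilpotent R (L ⧸ I) (L ⧸ I)
  rw [← LieIdeal.lowerCentralSeries_map_eq k (quotientHom_surjective I),
    LieIdeal.map_eq_bot_iff, ker_quotientHom] at hk
  exact ⟨k, hk⟩

end LowerCentral

section NilpotentIdeals

variable {F L : Type*} [Field F] [LieRing L] [LieAlgebra F L]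

theorem exists_lowerCentralSeries_le_nilpotentResidual [IsArtinian F L] :
    ∃ k, LieModule.lowerCentralSeries F L L k ≤ nilpotentResidual F L := by
  obtain ⟨k, hk⟩ := (LieModule.eventually_iInf_lowerCentralSeries_eq F L L).exists
  refine ⟨k, hk ▸ le_sInf fun I hI => ?_⟩
  obtain ⟨j, hj⟩ := exists_lowerCentralSeries_le_of_isNilpotent_quotient hI
  exact (iInf_le _ j).trans hj

theorem lie_self_le_frattini [LieAlgebra.IsSolvable L] {N : LieIdeal F L}
    (h : LieRing.IsNilpotent N) : (⁅N, N⁆ : LieIdeal F L).toLieSubalgebra ≤ frattini F L := by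
  refine le_sInf fun M hM => ?_
  obtain ⟨k, hk⟩ := exists_lowerCentral_eq_bot h
  by_cases hN : N.toLieSubalgebra ≤ M
  · exact (toLieSubalgebra_mono (LieSubmodule.lie_le_right N N)).trans hN
  obtain ⟨D, hD⟩ := exists_ideal_eq_inf_of_lowerCentral_le hM hN (k := k) (hk ▸ bot_le (a := M))
  have hDN : D ⋖ N := covBy_of_toLieSubalgebra_eq_inf hM hN hD
  exact (toLieSubalgebra_mono (lie_self_le_of_covBy hDN)).trans (hD.trans_le inf_le_left)

end NilpotentIdeals

section NilpotentPrefrattiniResidual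

variable {F L : Type*} [Field F] [LieRing L] [LieAlgebra F L] [FiniteDimensional F L]
  [LieAlgebra.IsSolvable L]

theorem prefrattiniResidual_le_of_ideal_eq_inf {M : LieSubalgebra F L} (hM : IsCoatom M)
    {D N : LieIdeal F L} (hπN : prefrattiniResidual F L ≤ N)
    (hD : D.toLieSubalgebra = M ⊓ N.toLieSubalgebra) :
    (prefrattiniResidual F L).toLieSubalgebra ≤ M := by
  have hDM : D.toLieSubalgebra ≤ M := hD.trans_le inf_le_left
  by_cases hN : N.toLieSubalgebra ≤ M
  · exact (toLieSubalgebra_mono hπN).trans hN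
  have hDN : D ⋖ N := covBy_of_toLieSubalgebra_eq_inf hM hN hD
  have hD_compl : IsComplementedOver D :=
    (prefrattiniResidual_le_iff.1 hπN).of_covBy hDN ⟨hM, hDM, hN⟩
  exact (toLieSubalgebra_mono (prefrattiniResidual_le hD_compl)).trans hDM

theorem prefrattiniResidual_le_frattini (h : LieRing.IsNilpotent (prefrattiniResidual F L)) :
    (prefrattiniResidual F L).toLieSubalgebra ≤ frattini F L := by
  refine le_sInf fun M hM => ?_
  by_contra hN
  obtain ⟨k, hk⟩ := exists_lowerCentral_eq_bot h
  obtain ⟨D, hD⟩ := exists_ideal_eq_inf_of_lowerCentral_le hM hN (k := k) (hk ▸ bot_le (a := M))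
  exact hN (prefrattiniResidual_le_of_ideal_eq_inf hM le_rfl hD)

theorem isNilpotent_prefrattiniResidual_iff :
    LieRing.IsNilpotent (prefrattiniResidual F L) ↔
      (prefrattiniResidual F L).toLieSubalgebra = frattini F L :=
  ⟨fun h => (prefrattiniResidual_le_frattini h).antisymm frattini_le_prefrattiniResidual,
    fun h => isNilpotent_of_le_frattini h.le⟩

namespace IsMaximalSupplement

variable {M : LieSubalgebra F L} {J A : LieIdeal F L}

theorem prefrattiniResidual_le_of_lie_le (hM : IsMaximalSupplement M J A) (h : J ⋖ A)
    (hlie : ⁅prefrattiniResidual F L, A⁆ ≤ J) :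
    (prefrattiniResidual F L).toLieSubalgebra ≤ M := by
  have hAN : ⁅A, prefrattiniResidual F L ⊔ A⁆ ≤ J := by
    rw [LieSubmodule.lie_sup, LieSubmodule.lie_comm]
    exact sup_le hlie (lie_self_le_of_covBy h)
  obtain ⟨D, hD⟩ := exists_ideal_eq_inf (N := prefrattiniResidual F L ⊔ A) hM.sup_eq_top
    fun a ha y hy _ => hM.le (hAN (LieSubmodule.lie_mem_lie ha hy))
  exact prefrattiniResidual_le_of_ideal_eq_inf hM.isCoatom le_sup_left hD

theorem prefrattiniResidual_le_of_not_le (hM : IsMaximalSupplement M J A) (h : J ⋖ A) {k : ℕ}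
    (hk : ¬ A ≤ lowerCentral (prefrattiniResidual F L) k ⊔ J) :
    (prefrattiniResidual F L).toLieSubalgebra ≤ M :=
  hM.prefrattiniResidual_le_of_lie_le h
    ((lie_le_or_le_lowerCentral_sup h _).resolve_right fun hle => hk (hle k))

end IsMaximalSupplement

end NilpotentPrefrattiniResidual

section PrefrattiniSubalgebras

namespace ChiefSeries

variable {F L : Type*} [Field F] [LieRing L] [LieAlgebra F L]

/-- `M i` is a maximal subalgebra avoiding the `i`-th factor of `s` whenever that factor is not
Frattini; these are the choices from which prefrattini subalgebras are formed. -/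
def IsSupplementFamily (s : ChiefSeries F L) (M : Fin s.n → LieSubalgebra F L) : Prop :=
  ∀ i, ¬ s.IsFrattini i → IsMaximalSupplement (M i) (s.A i.castSucc) (s.A i.succ)

/-- The intersection of those of the subalgebras `M i` that belong to a non-Frattini chief factor
`A (i+1) / A i` with `k ≤ i`; a prefrattini subalgebra is the case `k = 0`. -/
def partialInf (s : ChiefSeries F L) (M : Fin s.n → LieSubalgebra F L)
    (k : Fin (s.n + 1)) : LieSubalgebra F L :=
  ⨅ (i : Fin s.n) (_ : ¬ s.IsFrattini i ∧ k ≤ i.castSucc), M i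

variable {s : ChiefSeries F L} {M : Fin s.n → LieSubalgebra F L}

theorem partialInf_zero : s.partialInf M 0 = ⨅ (i : Fin s.n) (_ : ¬ s.IsFrattini i), M i := by
  simp only [partialInf, Fin.zero_le, and_true]

theorem partialInf_last : s.partialInf M (Fin.last s.n) = ⊤ :=
  iInf₂_eq_top.2 fun i hi => absurd (Fin.last_le_iff.1 hi.2) (Fin.castSucc_lt_last i).ne

theorem partialInf_le {k : Fin (s.n + 1)} {i : Fin s.n} (hi : ¬ s.IsFrattini i)
    (hk : k ≤ i.castSucc) : s.partialInf M k ≤ M i :=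
  iInf₂_le i ⟨hi, hk⟩

theorem partialInf_castSucc_le_succ (i : Fin s.n) :
    s.partialInf M i.castSucc ≤ s.partialInf M i.succ :=
  le_iInf₂ fun _ hj => partialInf_le hj.1 (i.castSucc_lt_succ.le.trans hj.2)

theorem le_partialInf_castSucc {S : LieSubalgebra F L} {i : Fin s.n}
    (hS : S ≤ s.partialInf M i.succ) (hi : ¬ s.IsFrattini i → S ≤ M i) :
    S ≤ s.partialInf M i.castSucc := by
  refine le_iInf₂ fun j ⟨hj, hij⟩ => ?_
  rcases eq_or_lt_of_le (Fin.castSucc_le_castSucc_iff.1 hij) with rfl | hlt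
  · exact hi hj
  · exact hS.trans (partialInf_le hj (Fin.succ_le_castSucc_iff.2 hlt))

theorem le_partialInf (hM : s.IsSupplementFamily M) (k : Fin (s.n + 1)) :
    (s.A k).toLieSubalgebra ≤ s.partialInf M k := by
  have hmono : Monotone s.A := Fin.monotone_iff_le_succ.2 fun i => (s.step i).le
  exact le_iInf₂ fun i hi => (toLieSubalgebra_mono (hmono hi.2)).trans (hM i hi.1).le

variable [FiniteDimensional F L] [LieAlgebra.IsSolvable L]

theorem le_of_isFrattini {i : Fin s.n} (hi : s.IsFrattini i) :
    s.A i.succ ≤ prefrattiniResidual F L ⊔ s.A i.castSucc := by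
  by_contra hle
  obtain ⟨M, hM⟩ := (isComplementedOver_prefrattiniResidual.mono
    (le_sup_left (b := s.A i.castSucc))).exists_isMaximalSupplement hle
  refine hM.not_le fun x hx => mem_of_map_mem_frattini (quotientHom_surjective (s.A i.castSucc))
    (hi (Submodule.mem_map_of_mem hx)) hM.isCoatom ?_
  rw [ker_quotientHom]
  exact (toLieSubalgebra_mono le_sup_right).trans hM.le

theorem partialInf_le_prefrattiniResidual_sup (hM : s.IsSupplementFamily M) (k : Fin (s.n + 1)) :
    s.partialInf M k ≤ (prefrattiniResidual F L ⊔ s.A k).toLieSubalgebra := by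
  induction k using Fin.reverseInduction with
  | last =>
    rw [s.top, sup_top_eq]
    exact le_top (a := s.partialInf M (Fin.last s.n))
  | cast i ih =>
    have hle := (partialInf_castSucc_le_succ i).trans ih
    by_cases hA : s.A i.succ ≤ prefrattiniResidual F L ⊔ s.A i.castSucc
    · exact hle.trans (toLieSubalgebra_mono (sup_le le_sup_left hA))
    have hi : ¬ s.IsFrattini i := fun hi => hA (le_of_isFrattini hi)
    have hπ : (prefrattiniResidual F L).toLieSubalgebra ≤ M i :=
      (hM i hi).prefrattiniResidual_le_of_not_le (s.step i) (k := 0) (by rwa [lowerCentral_zero])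
    calc s.partialInf M i.castSucc
        ≤ (prefrattiniResidual F L ⊔ s.A i.succ).toLieSubalgebra ⊓ M i :=
          le_inf hle (partialInf_le hi le_rfl)
      _ = (prefrattiniResidual F L ⊔ s.A i.castSucc).toLieSubalgebra := by
          rw [toLieSubalgebra_sup, sup_ideal_inf_of_le hπ, inf_comm, (hM i hi).inf_eq (s.step i),
            toLieSubalgebra_sup]

theorem prefrattiniResidual_le_partialInf_sup (hM : s.IsSupplementFamily M) (m : ℕ)
    (k : Fin (s.n + 1)) :
    (prefrattiniResidual F L).toLieSubalgebra ≤
      s.partialInf M k ⊔ (lowerCentral (prefrattiniResidual F L) m).toLieSubalgebra := by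
  set γ := lowerCentral (prefrattiniResidual F L) m
  induction k using Fin.reverseInduction with
  | last =>
    rw [partialInf_last, top_sup_eq]
    exact le_top
  | cast i ih =>
    by_cases hi : s.IsFrattini i
    · exact ih.trans (sup_le_sup_right (le_partialInf_castSucc le_rfl (absurd hi)) _)
    have hMi := hM i hi
    by_cases hA : s.A i.succ ≤ γ ⊔ s.A i.castSucc
    · have hA' : (s.A i.succ).toLieSubalgebra ≤
          s.partialInf M i.castSucc ⊔ γ.toLieSubalgebra := by
        refine (toLieSubalgebra_mono hA).trans ?_
        rw [toLieSubalgebra_sup, sup_comm]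
        exact sup_le_sup_right (le_partialInf hM _) _
      refine ih.trans (sup_le ?_ le_sup_right)
      rw [← inf_sup_ideal_of_sup_eq_top hMi.sup_eq_top (le_partialInf hM i.succ)]
      exact sup_le ((le_partialInf_castSucc inf_le_right fun _ => inf_le_left).trans
        le_sup_left) hA'
    · have hπ := hMi.prefrattiniResidual_le_of_not_le (s.step i) hA
      have hγ : γ.toLieSubalgebra ≤ M i := (toLieSubalgebra_mono (lowerCentral_le _ _)).trans hπ
      refine (le_inf ih hπ).trans ?_
      rw [sup_ideal_inf_of_ideal_le hγ]
      exact sup_le_sup_right (le_partialInf_castSucc inf_le_left fun _ => inf_le_right) _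

end ChiefSeries

variable {F L : Type*} [Field F] [LieRing L] [LieAlgebra F L] {B : LieSubalgebra F L}

theorem IsPrefrattini.exists_eq_partialInf (hB : IsPrefrattini B) :
    ∃ (s : ChiefSeries F L) (M : Fin s.n → LieSubalgebra F L),
      s.IsSupplementFamily M ∧ B = s.partialInf M 0 := by
  obtain ⟨s, M, hM, rfl⟩ := hB
  exact ⟨s, M, fun i hi => ⟨(hM i hi).1, (hM i hi).2.1, (hM i hi).2.2⟩,
    ChiefSeries.partialInf_zero.symm⟩

variable [FiniteDimensional F L] [LieAlgebra.IsSolvable L]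

theorem IsPrefrattini.le_prefrattiniResidual (hB : IsPrefrattini B) :
    B ≤ (prefrattiniResidual F L).toLieSubalgebra := by
  obtain ⟨s, M, hM, rfl⟩ := hB.exists_eq_partialInf
  simpa only [s.bot, sup_bot_eq] using ChiefSeries.partialInf_le_prefrattiniResidual_sup hM 0

theorem IsPrefrattini.prefrattiniResidual_le_sup_lowerCentral (hB : IsPrefrattini B) (m : ℕ) :
    (prefrattiniResidual F L).toLieSubalgebra ≤
      B ⊔ (lowerCentral (prefrattiniResidual F L) m).toLieSubalgebra := by
  obtain ⟨s, M, hM, rfl⟩ := hB.exists_eq_partialInf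
  exact ChiefSeries.prefrattiniResidual_le_partialInf_sup hM m 0

theorem IsPrefrattini.prefrattiniResidual_eq_sup_nilpotentResidual (hB : IsPrefrattini B) :
    (prefrattiniResidual F L).toSubmodule =
      B.toSubmodule ⊔ (nilpotentResidual F (prefrattiniResidual F L)).toSubmodule.map
        (prefrattiniResidual F L).toSubmodule.subtype := by
  refine le_antisymm (fun x hx => ?_) (sup_le hB.le_prefrattiniResidual ?_)
  · obtain ⟨m, hm⟩ :=
      exists_lowerCentralSeries_le_nilpotentResidual (F := F) (L := prefrattiniResidual F L)
    obtain ⟨b, hb, r, hr, rfl⟩ :=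
      mem_sup_ideal.1 (hB.prefrattiniResidual_le_sup_lowerCentral m hx)
    obtain ⟨y, hy, rfl⟩ := mem_lowerCentral_iff.1 hr
    exact Submodule.add_mem_sup hb ⟨y, hm hy, rfl⟩
  · rintro _ ⟨y, -, rfl⟩
    exact y.2

end PrefrattiniSubalgebras

section Elementary

variable {F L L' : Type*} [Field F] [LieRing L] [LieAlgebra F L] [LieRing L'] [LieAlgebra F L']

theorem frattini_eq_bot_of_equiv (e : L ≃ₗ⁅F⁆ L') (h : frattini F L = ⊥) : frattini F L' = ⊥ := by
  have hker : (e : L →ₗ⁅F⁆ L').ker = ⊥ := (LieHom.ker_eq_bot _).2 e.injective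
  exact frattini_eq_bot_of_surjective (f := (e : L →ₗ⁅F⁆ L')) e.surjective (by rw [hker, h]; rfl)

theorem IsElementary.frattini_eq_bot (h : IsElementary F L) : frattini F L = ⊥ :=
  frattini_eq_bot_of_equiv LieSubalgebra.topEquiv (h ⊤)

theorem IsElementary.of_injective (h : IsElementary F L) {f : L' →ₗ⁅F⁆ L}
    (hf : Function.Injective f) : IsElementary F L' := by
  intro S
  have hinj : Function.Injective (f.comp S.incl) := hf.comp Subtype.val_injective
  exact frattini_eq_bot_of_equiv (LieEquiv.ofInjective _ hinj).symm (h _)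

theorem IsElementary.frattini_eq_bot_of_le {M S : LieSubalgebra F L} (h : IsElementary F M)
    (hS : S ≤ M) : frattini F S = ⊥ := by
  have hinj : Function.Injective (M.incl.comp (S.comap M.incl).incl) :=
    Subtype.val_injective.comp Subtype.val_injective
  have hrange : (M.incl.comp (S.comap M.incl).incl).range = S :=
    le_antisymm (by rintro _ ⟨x, rfl⟩; exact x.2) fun x hx => ⟨⟨⟨x, hS hx⟩, hx⟩, rfl⟩
  rw [← hrange]
  exact frattini_eq_bot_of_equiv (LieEquiv.ofInjective _ hinj) (h _)

theorem isComplemented_iff_isComplementedOver_bot :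
    IsComplemented F L ↔ IsComplementedOver (⊥ : LieIdeal F L) := by
  have hker : (LieHom.id : L →ₗ⁅F⁆ L).ker = ⊥ := (LieHom.ker_eq_bot _).2 Function.injective_id
  rw [isComplemented_iff_of_surjective (f := LieHom.id) Function.surjective_id, hker]

theorem isComplementedOver_of_isComplemented_subalgebra {M : LieSubalgebra F L} {A : LieIdeal F L}
    (htop : M ⊔ A.toLieSubalgebra = ⊤) (h : IsComplemented F M) : IsComplementedOver A := by
  have hsurj : Function.Surjective ((quotientHom A).comp M.incl) := by
    intro y
    obtain ⟨x, rfl⟩ := quotientHom_surjective A y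
    obtain ⟨m, hm, a, ha, rfl⟩ := mem_sup_ideal.1 (htop ▸ LieSubalgebra.mem_top (R := F) x)
    have ha' : quotientHom A a = 0 := LieSubmodule.Quotient.mk_eq_zero'.2 ha
    exact ⟨⟨m, hm⟩, by rw [map_add, ha', add_zero]; rfl⟩
  rw [← isComplemented_quotient_iff, isComplemented_iff_of_surjective hsurj]
  exact (isComplemented_iff_isComplementedOver_bot.1 h).mono bot_le

theorem finrank_lt_of_isCoatom [FiniteDimensional F L] {M : LieSubalgebra F L} (hM : IsCoatom M) :
    Module.finrank F M < Module.finrank F L :=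
  Submodule.finrank_lt (s := M.toSubmodule) fun h => hM.1 (LieSubalgebra.toSubmodule_injective h)

/-- If `M` is a maximal subalgebra avoiding a minimal ideal `A`, then `M` maps onto `L / A`. -/
theorem IsElementary.isComplemented [FiniteDimensional F L] [LieAlgebra.IsSolvable L]
    (h : IsElementary F L) : IsComplemented F L := by
  induction hn : Module.finrank F L using Nat.strong_induction_on generalizing L with
  | _ n ih =>
    subst hn
    rw [isComplemented_iff_isComplementedOver_bot]
    rcases eq_bot_or_exists_atom_le (⊤ : LieIdeal F L) with htop | ⟨A, hA, -⟩
    · exact htop ▸ isComplementedOver_top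
    obtain ⟨M, hM, hAM⟩ : ∃ M : LieSubalgebra F L, IsCoatom M ∧ ¬ A.toLieSubalgebra ≤ M := by
      by_contra! hcon
      have hle : A.toLieSubalgebra ≤ frattini F L := le_sInf hcon
      rw [h.frattini_eq_bot] at hle
      exact hA.1 (eq_bot_iff.2 hle)
    have hMA : IsMaximalSupplement M ⊥ A := ⟨hM, bot_le (a := M), hAM⟩
    have hMc : IsComplemented F M :=
      ih _ (finrank_lt_of_isCoatom hM) (h.of_injective (f := M.incl) Subtype.val_injective) rfl
    exact (isComplementedOver_of_isComplemented_subalgebra hMA.sup_eq_top hMc).of_covBy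
      (bot_covBy_iff.2 hA) hMA

theorem prefrattiniResidual_le_elementaryCommutator [FiniteDimensional F L] :
    prefrattiniResidual F L ≤ elementaryCommutator F L :=
  sInf_le_sInf fun _ ⟨hs, he⟩ => ⟨hs, he.isComplemented⟩

end Elementary

section CompletelyReducible

variable {F L V : Type*} [Field F] [LieRing L] [AddCommGroup V] [Module F V] [LieRingModule L V]

theorem isAtom_or_eq_bot_map {W : LieSubmodule F L V} (hW : IsAtom W) (f : V →ₗ⁅F,L⁆ V) :
    IsAtom (W.map f) ∨ W.map f = ⊥ := by
  rw [or_iff_not_imp_right]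
  refine fun hne => ⟨hne, fun X hX => ?_⟩
  rcases hW.le_iff.1 (inf_le_left : W ⊓ X.comap f ≤ W) with hbot | hW_eq
  · rw [eq_bot_iff]
    intro y hy
    obtain ⟨w, hw, rfl⟩ := (LieSubmodule.mem_map _).1 (hX.le hy)
    have hw0 : w ∈ W ⊓ X.comap f := ⟨hw, hy⟩
    rw [hbot, LieSubmodule.mem_bot] at hw0
    rw [hw0, map_zero]
    exact LieSubmodule.zero_mem _
  · exact absurd (LieSubmodule.map_le_iff_le_comap.2 (inf_eq_left.1 hW_eq)) hX.not_ge

variable [LieAlgebra F L] [LieModule F L V]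

/-- The operators of `L` commute with those of `S`, so they preserve the `S`-socle of `V`. An
`L`-complement of the socle contains no simple `S`-submodule, hence is zero. -/
theorem complementedLattice_restrict [FiniteDimensional F V]
    [ComplementedLattice (LieSubmodule F L V)]
    (hcomm : ∀ (x y : L) (v : V), ⁅x, ⁅y, v⁆⁆ = ⁅y, ⁅x, v⁆⁆) (S : LieSubalgebra F L) :
    ComplementedLattice (LieSubmodule F S V) := by
  let soc : LieSubmodule F S V := sSup {W | IsAtom W}
  let act : L → (V →ₗ⁅F,S⁆ V) := fun x =>
    { LieModule.toEnd F L V x with map_lie' := fun {s v} => hcomm x s v }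
  have hact : ∀ x, soc ≤ soc.comap (act x) := fun x => sSup_le fun W hW => by
    rw [← LieSubmodule.map_le_iff_le_comap]
    rcases isAtom_or_eq_bot_map hW (act x) with h | h
    · exact le_sSup h
    · exact h ▸ bot_le
  let N : LieSubmodule F L V := { soc.toSubmodule with lie_mem := fun {x v} hv => hact x hv }
  obtain ⟨X, hX⟩ := exists_isCompl N
  have hX' : X.restr S = ⊥ := by
    refine (eq_bot_or_exists_atom_le _).resolve_right ?_
    rintro ⟨W, hW, hWX⟩
    refine hW.1 (eq_bot_iff.2 fun w hw => ?_)
    exact hX.inf_eq_bot.le ⟨(le_sSup hW : W ≤ soc) hw, hWX hw⟩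
  have hX_bot : X = ⊥ := eq_bot_iff.2 fun x hx => hX'.le hx
  have hN : N = ⊤ := by rw [← hX.sup_eq_top, hX_bot, sup_bot_eq]
  have hsoc : soc = ⊤ := eq_top_iff.2 fun v _ => hN.ge (LieSubmodule.mem_top v)
  exact complementedLattice_of_sSup_atoms_eq_top hsoc

end CompletelyReducible

section Splitting

variable {F L : Type*} [Field F] [LieRing L] [LieAlgebra F L]

theorem isCoatom_of_isCoatom_toSubmodule {M : LieSubalgebra F L} (hM : IsCoatom M.toSubmodule) :
    IsCoatom M := by
  refine ⟨fun h => hM.1 (h ▸ rfl), fun K hK => LieSubalgebra.toSubmodule_injective ?_⟩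
  exact hM.2 K.toSubmodule hK

theorem frattini_le_derivedSeries :
    frattini F L ≤ (LieAlgebra.derivedSeries F L 1).toLieSubalgebra := by
  intro x hx
  by_contra hxD
  obtain ⟨f, hfx, hf⟩ := Submodule.exists_le_ker_of_notMem hxD
  let M : LieSubalgebra F L := { LinearMap.ker f with
    lie_mem' := fun {y z} _ _ =>
      hf (LieSubmodule.lie_mem_lie (LieSubmodule.mem_top y) (LieSubmodule.mem_top z)) }
  have hM : IsCoatom M := isCoatom_of_isCoatom_toSubmodule <|
    LinearMap.isCoatom_ker_of_surjective <| LinearMap.surjective fun h => hfx (h ▸ rfl)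
  exact hfx (frattini_le hM hx)

variable [FiniteDimensional F L]

instance wellFoundedLT_lieSubalgebra : WellFoundedLT (LieSubalgebra F L) :=
  (show StrictMono (LieSubalgebra.toSubmodule (R := F) (L := L)) from fun _ _ h => h).wellFoundedLT

theorem exists_isCompl_of_abelian (hφ : frattini F L = ⊥) {A : LieIdeal F L} (hA : ⁅A, A⁆ = ⊥) :
    ∃ U : LieSubalgebra F L, IsCompl U A.toLieSubalgebra := by
  obtain ⟨U, hU, hmin⟩ := wellFounded_lt.has_min
    {U : LieSubalgebra F L | U ⊔ A.toLieSubalgebra = ⊤} ⟨⊤, top_sup_eq _⟩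
  obtain ⟨E, hE⟩ := exists_ideal_eq_inf (N := A) hU fun a ha y hy _ =>
    (LieSubmodule.lie_eq_bot_iff _ _).1 hA a ha y hy ▸ U.zero_mem
  have hEU : E.toLieSubalgebra ≤ U := hE.trans_le inf_le_left
  have hEA : E.toLieSubalgebra ≤ A.toLieSubalgebra := hE.trans_le inf_le_right
  have hEφ : E.toLieSubalgebra ≤ frattini F L := le_sInf fun M hM => by
    by_contra hEM
    have hMU : (M ⊓ U) ⊔ E.toLieSubalgebra = U :=
      inf_sup_ideal_of_sup_eq_top (sup_ideal_eq_top hM hEM) hEU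
    have hMUA : (M ⊓ U) ⊔ A.toLieSubalgebra = ⊤ := by
      rw [← sup_eq_right.2 hEA, ← sup_assoc, hMU, hU]
    exact hEM (hEU.trans (inf_eq_right.1 (inf_le_right.eq_of_not_lt (hmin _ hMUA))))
  exact ⟨U, disjoint_iff.2 (by rw [← hE, eq_bot_iff, ← hφ]; exact hEφ), codisjoint_iff.2 hU⟩

theorem complementedLattice_of_abelian (hφ : frattini F L = ⊥) {A : LieIdeal F L}
    (hA : ⁅A, A⁆ = ⊥) : ComplementedLattice (LieSubmodule F L A) := by
  refine ⟨fun X => ?_⟩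
  let X₀ : LieIdeal F L := X.map (LieSubmodule.incl A)
  have hX₀A : X₀ ≤ A := by
    rintro _ ⟨x, -, rfl⟩
    exact x.2
  obtain ⟨U, hU⟩ := exists_isCompl_of_abelian hφ (A := X₀)
    (eq_bot_iff.2 ((LieSubmodule.mono_lie hX₀A hX₀A).trans hA.le))
  obtain ⟨D, hD⟩ := exists_ideal_eq_inf (N := A) hU.sup_eq_top fun a ha y hy _ =>
    (LieSubmodule.lie_eq_bot_iff _ _).1 hA a (hX₀A ha) y hy ▸ U.zero_mem
  refine ⟨LieSubmodule.comap (LieSubmodule.incl A) D, disjoint_iff.2 (eq_bot_iff.2 ?_),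
    codisjoint_iff.2 (eq_top_iff.2 fun a _ => ?_)⟩
  · rintro x ⟨hx, hxD⟩
    exact Subtype.ext (hU.inf_eq_bot.le ⟨(hD.le hxD).1, ⟨x, hx, rfl⟩⟩)
  · obtain ⟨u, hu, _, ⟨x, hx, rfl⟩, hux⟩ :=
      mem_sup_ideal.1 (hU.sup_eq_top ▸ LieSubalgebra.mem_top (R := F) (a : L))
    have huA : u ∈ A := (add_mem_cancel_right x.2).1 (hux ▸ a.2)
    have huD : (⟨u, huA⟩ : A) ∈ LieSubmodule.comap (LieSubmodule.incl A) D := hD.ge ⟨hu, huA⟩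
    exact (LieSubmodule.mem_sup _ _ _).2 ⟨x, hx, _, huD, Subtype.ext ((add_comm _ _).trans hux)⟩

variable [LieAlgebra.IsSolvable L]

/-- A complement `X` of the preimage of `φ(L)` in `V` yields a subalgebra `K + f(X)` that together
with `φ(L)` generates `L`, so that `K + f(X) = L`. -/
theorem frattini_eq_bot_of_isCompl_range {V : Type*} [AddCommGroup V] [Module F V]
    [LieRingModule L V] [ComplementedLattice (LieSubmodule F L V)]
    {f : V →ₗ⁅F,L⁆ L} (hL : LieAlgebra.derivedSeries F L 1 ≤ f.range) {K : LieSubalgebra F L}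
    (hK : IsCompl K (LieIdeal.toLieSubalgebra F L f.range)) : frattini F L = ⊥ := by
  obtain ⟨P, hP⟩ := exists_ideal_eq_frattini (F := F) (L := L)
  have hP_range : P ≤ f.range := le_trans (hP.trans_le frattini_le_derivedSeries) hL
  obtain ⟨X, hX⟩ := exists_isCompl (LieSubmodule.comap f P)
  let Y : LieIdeal F L := X.map f
  have hY_range : Y ≤ f.range := by
    rintro _ ⟨x, -, rfl⟩
    exact ⟨x, rfl⟩
  have htop : K ⊔ Y.toLieSubalgebra = ⊤ := by
    refine eq_top_of_sup_frattini (eq_top_iff.2 (hK.sup_eq_top.ge.trans ?_))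
    refine sup_le (le_sup_left.trans le_sup_left) ?_
    rintro _ ⟨v, rfl⟩
    obtain ⟨w, hw, x, hx, rfl⟩ :=
      (LieSubmodule.mem_sup _ _ _).1 (hX.sup_eq_top.ge (LieSubmodule.mem_top v))
    have hw' : f w ∈ frattini F L := hP.le hw
    have hx' : f x ∈ Y.toLieSubalgebra := ⟨x, hx, rfl⟩
    exact map_add f w x ▸ add_mem (le_sup_right (a := K ⊔ Y.toLieSubalgebra) hw')
      (le_sup_left (b := frattini F L) (le_sup_right (a := K) hx'))
  have hY : f.range = Y := by
    have h := inf_sup_ideal_of_sup_eq_top htop (T := LieIdeal.toLieSubalgebra F L f.range) hY_range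
    rw [hK.inf_eq_bot, bot_sup_eq] at h
    exact (toLieSubalgebra_injective h).symm
  rw [← hP, eq_bot_iff]
  intro p hp
  obtain ⟨x, hx, rfl⟩ := hY.le (hP_range hp)
  have hx0 : x ∈ LieSubmodule.comap f P ⊓ X := ⟨hp, hx⟩
  rw [hX.inf_eq_bot, LieSubmodule.mem_bot] at hx0
  rw [hx0]
  exact map_zero f

end Splitting

section CompletelySolvable

variable {F L : Type*} [Field F] [LieRing L] [LieAlgebra F L]

theorem derivedSeries_subalgebra_eq_bot {k : ℕ} (h : LieAlgebra.derivedSeries F L k = ⊥)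
    (S : LieSubalgebra F L) : LieAlgebra.derivedSeries F S k = ⊥ := by
  have hker : S.incl.ker = ⊥ := (LieHom.ker_eq_bot _).2 Subtype.val_injective
  have hmap : (LieAlgebra.derivedSeries F S k).map S.incl = ⊥ :=
    eq_bot_iff.2 ((LieIdeal.derivedSeries_map_le k).trans h.le)
  exact eq_bot_iff.2 ((LieIdeal.map_eq_bot_iff.1 hmap).trans hker.le)

theorem exists_ideal_eq_inf_of_isCoatom {M : LieSubalgebra F L} (hM : IsCoatom M) {A : LieIdeal F L}
    (hA : ⁅A, A⁆ = ⊥) : ∃ B : LieIdeal F L, B.toLieSubalgebra = M ⊓ A.toLieSubalgebra := by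
  by_cases hAM : A.toLieSubalgebra ≤ M
  · exact ⟨A, (inf_eq_right.2 hAM).symm⟩
  · exact exists_ideal_eq_inf (sup_ideal_eq_top hM hAM) fun a ha y hy _ =>
      (LieSubmodule.lie_eq_bot_iff _ _).1 hA a ha y hy ▸ M.zero_mem

variable [FiniteDimensional F L] [LieAlgebra.IsSolvable L]

theorem frattini_eq_bot_of_isCoatom (hφ : frattini F L = ⊥)
    (hL : LieAlgebra.derivedSeries F L 2 = ⊥) {M : LieSubalgebra F L} (hM : IsCoatom M) :
    frattini F M = ⊥ := by
  let A := LieAlgebra.derivedSeries F L 1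
  have hA : ⁅A, A⁆ = ⊥ := hL
  have hlie : ∀ x y : L, ⁅x, y⁆ ∈ A := fun x y =>
    LieSubmodule.lie_mem_lie (LieSubmodule.mem_top x) (LieSubmodule.mem_top y)
  obtain ⟨B, hB⟩ := exists_ideal_eq_inf_of_isCoatom hM hA
  have hBA : B ≤ A := fun b hb => (hB.le hb).2
  have hBB : ⁅B, B⁆ = ⊥ := eq_bot_iff.2 ((LieSubmodule.mono_lie hBA hBA).trans hA.le)
  obtain ⟨U, hU⟩ := exists_isCompl_of_abelian hφ hBB
  have := complementedLattice_of_abelian hφ hBB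
  have hcomm : ∀ (x y : L) (b : B), ⁅x, ⁅y, b⁆⁆ = ⁅y, ⁅x, b⁆⁆ := fun x y b => by
    have hxy : ⁅⁅x, y⁆, (b : L)⁆ = 0 :=
      (LieSubmodule.lie_eq_bot_iff _ _).1 hA _ (hlie x y) _ (hBA b.2)
    rw [← sub_eq_zero, ← lie_lie]
    exact Subtype.ext hxy
  have := complementedLattice_restrict hcomm M
  let f : B →ₗ⁅F,M⁆ M :=
    { toFun := fun b => ⟨b, (hB.le b.2).1⟩
      map_add' := fun _ _ => rfl
      map_smul' := fun _ _ => rfl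
      map_lie' := rfl }
  refine frattini_eq_bot_of_isCompl_range (f := f) (K := U.comap M.incl) ?_ ⟨?_, ?_⟩
  · refine (LieSubmodule.lie_le_iff _ _ _).2 fun x _ y _ => ?_
    exact ⟨⟨⁅(x : L), (y : L)⁆, hB.ge ⟨M.lie_mem x.2 y.2, hlie x y⟩⟩, rfl⟩
  · rw [disjoint_iff, eq_bot_iff]
    rintro _ ⟨hu, b, rfl⟩
    exact Subtype.ext (hU.inf_eq_bot.le ⟨hu, b.2⟩)
  · rw [codisjoint_iff, eq_top_iff]
    intro m _
    obtain ⟨u, hu, b, hb, hub⟩ :=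
      mem_sup_ideal.1 (hU.sup_eq_top ▸ LieSubalgebra.mem_top (R := F) (m : L))
    have huM : u ∈ M := (add_mem_cancel_right (hB.le hb).1).1 (hub ▸ m.2)
    exact mem_sup_ideal.2 ⟨⟨u, huM⟩, hu, f ⟨b, hb⟩, ⟨⟨b, hb⟩, rfl⟩, Subtype.ext hub⟩

theorem isElementary_of_frattini_eq_bot (hφ : frattini F L = ⊥)
    (hL : LieAlgebra.derivedSeries F L 2 = ⊥) : IsElementary F L := by
  induction hn : Module.finrank F L using Nat.strong_induction_on generalizing L with
  | _ n ih =>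
    subst hn
    intro S
    rcases eq_top_or_exists_le_coatom S with rfl | ⟨M, hM, hSM⟩
    · exact frattini_eq_bot_of_equiv LieSubalgebra.topEquiv.symm hφ
    · have hMe : IsElementary F M := ih _ (finrank_lt_of_isCoatom hM)
        (frattini_eq_bot_of_isCoatom hφ hL hM) (derivedSeries_subalgebra_eq_bot hL M) rfl
      exact hMe.frattini_eq_bot_of_le hSM

theorem IsCompletelySolvable.isElementary_quotient (h : IsCompletelySolvable F L)
    {P : LieIdeal F L} (hP : P.toLieSubalgebra = frattini F L) : IsElementary F (L ⧸ P) := by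
  have hDP : LieAlgebra.derivedSeries F L 2 ≤ P := fun x hx =>
    hP.ge (lie_self_le_frattini h hx)
  refine isElementary_of_frattini_eq_bot
    (frattini_eq_bot_of_surjective (quotientHom_surjective P) (by rw [ker_quotientHom, hP])) ?_
  rw [← LieIdeal.derivedSeries_map_eq 2 (quotientHom_surjective P), LieIdeal.map_eq_bot_iff,
    ker_quotientHom]
  exact hDP

theorem IsCompletelySolvable.frattini_eq_and_prefrattiniResidual_eq (h : IsCompletelySolvable F L) :
    frattini F L = (prefrattiniResidual F L).toLieSubalgebra ∧
      prefrattiniResidual F L = elementaryCommutator F L := by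
  obtain ⟨P, hP⟩ := exists_ideal_eq_frattini (F := F) (L := L)
  have hE : elementaryCommutator F L ≤ P := sInf_le ⟨inferInstance, h.isElementary_quotient hP⟩
  have hπ : P ≤ prefrattiniResidual F L := hP.trans_le frattini_le_prefrattiniResidual
  have hπE : prefrattiniResidual F L ≤ elementaryCommutator F L :=
    prefrattiniResidual_le_elementaryCommutator
  have hPπ : P = prefrattiniResidual F L := le_antisymm hπ (hπE.trans hE)
  exact ⟨hPπ ▸ hP.symm, le_antisymm hπE (hE.trans hπ)⟩

end CompletelySolvable

end SolvLie

theorem proposition2p6 {F L : Type*} [Field F] [LieRing L] [LieAlgebra F L]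
    [FiniteDimensional F L] [LieAlgebra.IsSolvable L] :
    -- (i)
    (SolvLie.frattini F L ≤ (SolvLie.prefrattiniResidual F L).toLieSubalgebra ∧
      SolvLie.prefrattiniResidual F L ≤ SolvLie.elementaryCommutator F L ∧
      (SolvLie.IsCompletelySolvable F L →
        SolvLie.frattini F L = (SolvLie.prefrattiniResidual F L).toLieSubalgebra ∧
        SolvLie.prefrattiniResidual F L = SolvLie.elementaryCommutator F L)) ∧
    -- (ii)
    ((∀ A : LieIdeal F L,
        (SolvLie.prefrattiniResidual F (L ⧸ A)).toSubmodule =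
          (SolvLie.prefrattiniResidual F L ⊔ A).toSubmodule.map
            (LieSubmodule.Quotient.mk' A : L →ₗ[F] L ⧸ A)) ∧
      -- the Frattini subalgebra is an ideal `P`, and `π(L / P) = π(L) / P`
      (∃ P : LieIdeal F L, P.toLieSubalgebra = SolvLie.frattini F L ∧
        (SolvLie.prefrattiniResidual F (L ⧸ P)).toSubmodule =
          (SolvLie.prefrattiniResidual F L).toSubmodule.map
            (LieSubmodule.Quotient.mk' P : L →ₗ[F] L ⧸ P))) ∧
    -- (iii)
    (LieRing.IsNilpotent (SolvLie.prefrattiniResidual F L) ↔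
      (SolvLie.prefrattiniResidual F L).toLieSubalgebra = SolvLie.frattini F L) ∧
    -- (iv)
    (∀ B : LieSubalgebra F L, SolvLie.IsPrefrattini B →
      (SolvLie.prefrattiniResidual F L).toSubmodule =
        B.toSubmodule ⊔
          (SolvLie.nilpotentResidual F (SolvLie.prefrattiniResidual F L)).toSubmodule.map
            (SolvLie.prefrattiniResidual F L).toSubmodule.subtype) := by
  obtain ⟨P, hP⟩ := SolvLie.exists_ideal_eq_frattini (F := F) (L := L)
  refine ⟨⟨SolvLie.frattini_le_prefrattiniResidual,
      SolvLie.prefrattiniResidual_le_elementaryCommutator,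
      SolvLie.IsCompletelySolvable.frattini_eq_and_prefrattiniResidual_eq⟩,
    ⟨fun A => ?_, P, hP, SolvLie.toSubmodule_prefrattiniResidual_quotient P⟩,
    SolvLie.isNilpotent_prefrattiniResidual_iff,
    fun B hB => hB.prefrattiniResidual_eq_sup_nilpotentResidual⟩
  rw [SolvLie.map_mk_sup_self, SolvLie.toSubmodule_prefrattiniResidual_quotient]
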